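/- Let $n>m>1$ be integers. A *normal system* in $\mathbb{R}^m$ is a family $\mathcal N=\{L_1,\dots,L_n\}$ of $n$ lines through the origin such that, for nonzero vectors $v_i\in L_i$, any at most $m$ of the vectors $v_1,\dots,v_n$ are linearly independent. Fix a coefficient matrix $(a_{ij})\in M_{n\times m}(\mathbb R)$, whose $i$-th row is a nonzero vector of $L_i$. Let $\mathcal E$ be the set of all subsets of $\{1,\dots,n\}$ of size $m+1$. For $S=\{i_1<\dots<i_{m+1}\}\in\mathcal E$ let $M_S\subset\mathbb R^n$ be the hyperplane of all $y$ for which the $(m+1)\times(m+1)$ determinant with rows $(a_{i_k1},\dots,a_{i_km},y_{i_k})$, $1\le k\le m+1$, vanishes. The *discriminantal arrangement* of $\mathcal N$ is $\mathcal C=\{M_S : S\in\mathcal E\}$. A collection $\mathcal D\subseteq\mathcal E$ *forces* $S\in\mathcal E$ if there are $S_1,\dots,S_r\in\mathcal D$, all different from $S$, with $\#\bigcup_{j\in J}S_j\ge m+\#J$ for every nonempty $J\subseteq\{1,\dots,r\}$ and $\#(S_1\cup\dots\cup S_r\cup S)<m+r+1$. The collection $\mathcal D$ is *concurrency closed* if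 it contains every $S$ that it forces; its *concurrency closure* $\overline{\mathcal D}$ is obtained by repeatedly adding all forced sets until nothing changes. A *base collection* for $\mathcal D$ is a collection $\mathcal B\subseteq\mathcal E$ that is minimal under inclusion among those with $\overline{\mathcal B}=\overline{\mathcal D}$. The normal system is *concurrency free* if for every concurrency closed $\mathcal D\subseteq\mathcal E$ and every base collection $\mathcal B$ for $\mathcal D$, $$\#\mathcal B=n-\dim\bigcap_{S\in\mathcal D}M_S=n-\dim\bigcap_{S\in\mathcal B}M_S .$$ The characteristic polynomial of $\mathcal C$ is $\chi(\mathcal C)(x)=\sum_{X}\mu(\mathbb R^n,X)\,x^{\dim X}$, where $X$ runs over all intersections of members of $\mathcal C$ (including $\mathbb R^n$) ordered by reverse inclusion and $\mu$ is the Möbius function of this poset; $r(\mathcal C)$ is the number of regions, i.e. of connected components of $\mathbb R^n\setminus\bigcup_{S\in\mathcal E} M_S$. **Theorem.** Let $\mathcal N$ be a concurrency free normal system of $n$ lines in $\mathbb R^m$ with discriminantal arrangement $\mathcal C$. For every $\mathcal D\subseteq\mathcal E$, all base collections for $\overline{\mathcal D}$ have the same cardinality, denoted $\operatorname{rank}(\overline{\mathcal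 D})$, and it is at most $n$. Put $d_{\mathcal D}=n-\operatorname{rank}(\overline{\mathcal D})$. Then $$\chi(\mathcal C)(x)=\sum_{\mathcal D\subseteq\mathcal E}(-1)^{\#\mathcal D}x^{d_{\mathcal D}}$$ and $$r(\mathcal C)=(-1)^n\chi(\mathcal C)(-1)=\sum_{\mathcal D\subseteq\mathcal E}(-1)^{n+\#\mathcal D+d_{\mathcal D}}=\sum_{\mathcal D\subseteq\mathcal E}(-1)^{\#\mathcal D+\operatorname{rank}(\overline{\mathcal D})}.$$ In particular, $\chi(\mathcal C)$ and $r(\mathcal C)$ are the same for any two concurrency free normal systems of $n$ lines in $\mathbb R^m$ (and any choices of coefficient matrices): they depend only on $n$ and $m$. -/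

import Mathlib

open Polynomial

namespace Discriminantal

noncomputable section

open scoped Classical

/-! ### Central hyperplane arrangements -/

section Arrangements

variable {V : Type*} [AddCommGroup V] [Module ℝ V]

/-- All intersections of subfamilies of a finite family of linear subspaces; the empty
intersection, i.e. the whole space, is included. -/
def intersections (A : Finset (Submodule ℝ V)) : Finset (Submodule ℝ V) :=
  A.powerset.image fun B => sInf (B : Set (Submodule ℝ V))

/-- The intersection poset of an arrangement: all intersections, ordered by reverse inclusion. -/
abbrev IntersectionPoset (A : Finset (Submodule ℝ V)) : Type _ := (↥(intersections A))ᵒᵈ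

theorem top_mem_intersections (A : Finset (Submodule ℝ V)) : ⊤ ∈ intersections A :=
  Finset.mem_image.2 ⟨∅, by simp, by simp⟩

/-- The least element of the intersection poset, which is the whole space. -/
def ambient (A : Finset (Submodule ℝ V)) : IntersectionPoset A :=
  OrderDual.toDual ⟨⊤, top_mem_intersections A⟩

instance (A : Finset (Submodule ℝ V)) : LocallyFiniteOrder (IntersectionPoset A) :=
  Fintype.toLocallyFiniteOrder

/-- The characteristic polynomial `∑ X, μ(V, X) x ^ dim X` of a central arrangement, the sum being
over the intersection poset and `μ` its Möbius function. -/
def charPoly (A : Finset (Submodule ℝ V)) : ℤ[X] :=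
  ∑ Y : IntersectionPoset A,
    C (IncidenceAlgebra.mu ℤ (ambient A) Y) *
      X ^ Module.finrank ℝ ((OrderDual.ofDual Y : ↥(intersections A)) : Submodule ℝ V)

/-- The number of regions of an arrangement: the number of connected components of the complement
of the union of its hyperplanes. -/
def numRegions [TopologicalSpace V] (A : Finset (Submodule ℝ V)) : ℕ :=
  Nat.card (ConnectedComponents ↥((⋃ H ∈ A, (H : Set V))ᶜ))

end Arrangements

/-! ### Normal systems and the discriminantal arrangement -/

section Systems

variable {n m : ℕ}

/-- A normal system: lines `L 1, …, L n` through the origin of `ℝ ^ m` such that, for nonzero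
vectors `v i` on these lines, any at most `m` of them are linearly independent. -/
structure IsNormalSystem (L : Fin n → Submodule ℝ (Fin m → ℝ)) : Prop where
  isLine : ∀ i, Module.finrank ℝ (L i) = 1
  linearIndependent : ∀ v : Fin n → Fin m → ℝ, (∀ i, v i ∈ L i ∧ v i ≠ 0) →
    ∀ s : Finset (Fin n), s.card ≤ m → LinearIndependent ℝ fun i : s => v i

/-- A coefficient matrix of a system of lines: its `i`-th row is a nonzero vector on the `i`-th
line. -/
def IsCoefficientMatrix (L : Fin n → Submodule ℝ (Fin m → ℝ)) (a : Matrix (Fin n) (Fin m) ℝ) :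
    Prop :=
  ∀ i, a i ∈ L i ∧ a i ≠ 0

variable (n m) in
/-- The collection of all subsets of `{1, …, n}` of size `m + 1`, as a type. -/
abbrev Block : Type := {S : Finset (Fin n) // S.card = m + 1}

/-- For `S = {i_1 < ⋯ < i_{m+1}}`, the square matrix whose `k`-th row is
`(a_{i_k 1}, …, a_{i_k m}, y_{i_k})`. -/
def augmented (a : Matrix (Fin n) (Fin m) ℝ) (S : Block n m) (y : Fin n → ℝ) :
    Matrix (Fin (m + 1)) (Fin (m + 1)) ℝ :=
  Matrix.of fun k => Fin.snoc (α := fun _ => ℝ) (a (S.1.orderEmbOfFin S.2 k))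
    (y (S.1.orderEmbOfFin S.2 k))

theorem augmented_eq_updateCol (a : Matrix (Fin n) (Fin m) ℝ) (S : Block n m) (y : Fin n → ℝ) :
    augmented a S y = (augmented a S 0).updateCol (Fin.last m)
      (fun k => y (S.1.orderEmbOfFin S.2 k)) := by
  ext k j
  refine Fin.lastCases ?_ (fun j => ?_) j <;> simp [augmented]

/-- The hyperplane of `ℝ ^ n` on which the determinant of the augmented matrix vanishes. -/
def hyperplane (a : Matrix (Fin n) (Fin m) ℝ) (S : Block n m) : Submodule ℝ (Fin n → ℝ) where
  carrier := {y | (augmented a S y).det = 0}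
  add_mem' := by
    intro y z hy hz
    simp only [Set.mem_ofPred_eq] at *
    rw [augmented_eq_updateCol] at hy hz ⊢
    have := Matrix.det_updateCol_add (augmented a S 0) (Fin.last m)
      (fun k => y (S.1.orderEmbOfFin S.2 k)) (fun k => z (S.1.orderEmbOfFin S.2 k))
    rw [hy, hz, add_zero] at this
    exact this
  zero_mem' := by
    simp only [Set.mem_ofPred_eq]
    exact Matrix.det_eq_zero_of_column_eq_zero (Fin.last m) fun k => by simp [augmented]
  smul_mem' := by
    intro c y hy
    simp only [Set.mem_ofPred_eq] at *
    rw [augmented_eq_updateCol] at hy ⊢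
    have := Matrix.det_updateCol_smul (augmented a S 0) (Fin.last m) c
      (fun k => y (S.1.orderEmbOfFin S.2 k))
    rw [hy, mul_zero] at this
    exact this

/-- The discriminantal arrangement in `ℝ ^ n`. -/
def discriminantalArrangement (a : Matrix (Fin n) (Fin m) ℝ) : Finset (Submodule ℝ (Fin n → ℝ)) :=
  Finset.univ.image (hyperplane a)

/-! ### Concurrency closure, bases, rank -/

/-- The criterion for `S` to be forced by `D`: there are `S_1, …, S_r` in `D`, all different from
`S`, with `#⋃_{j ∈ J} S_j ≥ m + #J` for every nonempty `J ⊆ {1, …, r}` and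
`#(S_1 ∪ ⋯ ∪ S_r ∪ S) < m + r + 1`. -/
def Forces (D : Finset (Block n m)) (S : Block n m) : Prop :=
  ∃ I ⊆ D, S ∉ I ∧
    (∀ J ⊆ I, J.Nonempty → m + J.card ≤ (J.biUnion Subtype.val).card) ∧
    (I.biUnion Subtype.val ∪ S.1).card < m + I.card + 1

/-- A collection is concurrency closed if it contains everything it forces. -/
def IsConcurrencyClosed (D : Finset (Block n m)) : Prop :=
  ∀ S, Forces D S → S ∈ D

/-- One step of the closure construction: add all forced blocks. -/
def closureStep (D : Finset (Block n m)) : Finset (Block n m) :=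
  D ∪ Finset.univ.filter (Forces D)

/-- The concurrency closure: the union of `D_0 = D ⊆ D_1 ⊆ D_2 ⊆ ⋯`, where `D_{k+1}` is obtained
from `D_k` by adding all forced blocks. -/
def concurrencyClosure (D : Finset (Block n m)) : Finset (Block n m) :=
  Finset.univ.filter fun S => ∃ k : ℕ, S ∈ closureStep^[k] D

theorem Forces.mono {D D' : Finset (Block n m)} (h : D ⊆ D') {S : Block n m} (hS : Forces D S) :
    Forces D' S := by
  obtain ⟨I, hI, h'⟩ := hS
  exact ⟨I, hI.trans h, h'⟩

theorem subset_concurrencyClosure (D : Finset (Block n m)) : D ⊆ concurrencyClosure D :=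
  fun S hS => Finset.mem_filter.2 ⟨Finset.mem_univ S, 0, hS⟩

theorem iterate_closureStep_mono (D : Finset (Block n m)) :
    Monotone fun k : ℕ => closureStep^[k] D := by
  refine monotone_nat_of_le_succ fun k => ?_
  rw [Function.iterate_succ_apply']
  exact Finset.subset_union_left

theorem isConcurrencyClosed_concurrencyClosure (D : Finset (Block n m)) :
    IsConcurrencyClosed (concurrencyClosure D) := by
  intro S ⟨I, hI, h⟩
  have key : ∃ k : ℕ, I ⊆ closureStep^[k] D := by
    have h1 : ∀ T ∈ I, ∃ k : ℕ, T ∈ closureStep^[k] D := fun T hT =>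
      (Finset.mem_filter.1 (hI hT)).2
    choose! f hf using h1
    exact ⟨I.sup f, fun T hT => iterate_closureStep_mono D (Finset.le_sup hT) (hf T hT)⟩
  obtain ⟨k, hk⟩ := key
  refine Finset.mem_filter.2 ⟨Finset.mem_univ S, k + 1, ?_⟩
  rw [Function.iterate_succ_apply']
  exact Finset.mem_union_right _ (Finset.mem_filter.2 ⟨Finset.mem_univ S, I, hk, h⟩)

theorem concurrencyClosure_subset {D D' : Finset (Block n m)} (h : D ⊆ D')
    (hD' : IsConcurrencyClosed D') : concurrencyClosure D ⊆ D' := by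
  intro S hS
  obtain ⟨-, k, hk⟩ := Finset.mem_filter.1 hS
  have key : ∀ k : ℕ, closureStep^[k] D ⊆ D' := by
    intro k
    induction k with
    | zero => exact h
    | succ k ih =>
      rw [Function.iterate_succ_apply']
      refine Finset.union_subset ih fun T hT => hD' T ?_
      exact Forces.mono ih (Finset.mem_filter.1 hT).2
  exact key k hk

/-- `B` is a base collection for `D`: it has the same closure and is minimal with this property. -/
def IsBase (B D : Finset (Block n m)) : Prop :=
  concurrencyClosure B = concurrencyClosure D ∧
    ∀ B' ⊆ B, concurrencyClosure B' = concurrencyClosure D → B' = B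

theorem exists_isBase (D : Finset (Block n m)) : ∃ B, IsBase B D := by
  obtain ⟨B, hB⟩ := (Set.toFinite {B | concurrencyClosure B = concurrencyClosure D}).exists_minimal
    ⟨D, rfl⟩
  exact ⟨B, hB.prop, fun B' hB' h => hB.eq_of_le h hB'⟩

/-- The rank of `D`: the cardinality of a base collection for `D` (the least one, a priori). -/
def collectionRank (D : Finset (Block n m)) : ℕ :=
  sInf {k | ∃ B, IsBase B D ∧ B.card = k}

/-- `d_D = n - rank` of the closure of `D`. -/
def closureDim (D : Finset (Block n m)) : ℕ :=
  n - collectionRank (concurrencyClosure D)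

/-- A normal system with coefficient matrix `a` is concurrency free if, for every concurrency
closed collection `D` and every base collection `B` for `D`, the cardinality of `B` is the
codimension both of the intersection of the hyperplanes in `D` and of the intersection of the
hyperplanes in `B`. -/
def ConcurrencyFree (a : Matrix (Fin n) (Fin m) ℝ) : Prop :=
  ∀ D : Finset (Block n m), IsConcurrencyClosed D → ∀ B, IsBase B D →
    (B.card : ℤ) = n - Module.finrank ℝ ↥(⨅ S ∈ D, hyperplane a S) ∧
    (B.card : ℤ) = n - Module.finrank ℝ ↥(⨅ S ∈ B, hyperplane a S)

end Systems

end

end Discriminantal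

/-!
The codimension of an intersection of hyperplanes `M_S` is a combinatorial quantity for a
concurrency free system, and both the characteristic polynomial and the number of regions are
determined by these codimensions.

*Codimensions.* Any collection `D` contains a base `B` of its own closure
(`exists_isBase_subset`). The intersection of the hyperplanes in `D` lies between the one over the
closure of `D` and the one over `B`, and concurrency freeness gives the two outer subspaces the same
dimension `n - #B`. Hence `closureDim D` is the dimension of `⨅ S ∈ D, hyperplane a S`
(`ConcurrencyFree.closureDim_eq`).

*Whitney's theorem* (`charPoly_image`). For a finite family of proper subspaces `h i`, the function
`X ↦ ∑ (-1) ^ #D`, over those `D` with `⨅ i ∈ D, h i = X`, satisfies the recursion which defines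
`μ(V, X)`: summing it over all `Y ⊇ X` gives the alternating sum over the subsets of
`{i | X ≤ h i}`, a set which is empty exactly when `X` is the whole space.

*Zaslavsky's theorem* (`natCast_numRegions_image`). The regions correspond to the sign patterns
which the defining functionals realize off the hyperplanes, since each such pattern cuts out a convex
set and is locally constant. Sign patterns are counted by deletion and restriction
(`card_realizable_insert`): adding a functional `g` splits exactly those regions that meet `ker g`,
and these correspond to the regions of the arrangement restricted to `ker g`. The alternating sum
`∑ (-1) ^ (#B + codim B)` over subfamilies satisfies the same recursion (`card_realizable`).
-/

namespace Discriminantal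

/-! ### Whitney's theorem -/

section Whitney

open scoped Classical

/-- The defining recursion of the Möbius function, started at a least element, determines it. -/
theorem eq_mu_of_sum_Icc {α : Type*} [PartialOrder α] [LocallyFiniteOrder α] [DecidableEq α]
    (a : α) (g : α → ℤ) (ha : ∀ b, a ≤ b)
    (hg : ∀ b, ∑ c ∈ Finset.Icc a b, g c = if a = b then 1 else 0) (b : α) :
    g b = IncidenceAlgebra.mu ℤ a b := by
  suffices H : ∀ k : ℕ, ∀ b, (Finset.Icc a b).card = k → g b = IncidenceAlgebra.mu ℤ a b from
    H _ b rfl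
  intro k
  induction k using Nat.strong_induction_on with
  | _ k ih =>
    intro b hb
    have h1 := hg b
    have h2 := IncidenceAlgebra.sum_Icc_mu_right (𝕜 := ℤ) a b
    rw [← h2, ← Finset.Ico_insert_right (ha b),
      Finset.sum_insert Finset.right_notMem_Ico, Finset.sum_insert Finset.right_notMem_Ico] at h1
    have h3 : ∑ c ∈ Finset.Ico a b, g c = ∑ c ∈ Finset.Ico a b, IncidenceAlgebra.mu ℤ a c := by
      refine Finset.sum_congr rfl fun c hc => ?_
      have hc' := (Finset.mem_Ico.1 hc).2
      refine ih _ ?_ c rfl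
      rw [← hb]
      refine Finset.card_lt_card ⟨Finset.Icc_subset_Icc le_rfl hc'.le, fun h => ?_⟩
      exact hc'.not_ge (Finset.mem_Icc.1 (h (Finset.right_mem_Icc.2 (ha b)))).2
    linarith

variable {V : Type*} [AddCommGroup V] [Module ℝ V] {ι : Type*} [Fintype ι]

theorem mem_intersections {A : Finset (Submodule ℝ V)} {X : Submodule ℝ V} :
    X ∈ intersections A ↔ ∃ B ⊆ A, sInf (B : Set (Submodule ℝ V)) = X := by
  -- the subfamilies `B` enter `intersections` as sets, coerced elementwise by the `Finset` monad
  simp [intersections, Finset.bind_def, Finset.pure_def]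

theorem iInf_mem_intersections (h : ι → Submodule ℝ V) (D : Finset ι) :
    ⨅ i ∈ D, h i ∈ intersections (Finset.univ.image h) := by
  refine mem_intersections.2 ⟨D.image h, Finset.image_subset_image (Finset.subset_univ D), ?_⟩
  rw [Finset.coe_image, sInf_image]
  rfl

/-- The intersection of a subfamily, as an element of the intersection poset. -/
noncomputable def flat (h : ι → Submodule ℝ V) (D : Finset ι) :
    IntersectionPoset (Finset.univ.image h) :=
  OrderDual.toDual ⟨⨅ i ∈ D, h i, iInf_mem_intersections h D⟩

theorem ambient_le (A : Finset (Submodule ℝ V)) (Y : IntersectionPoset A) : ambient A ≤ Y :=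
  OrderDual.toDual_le.2 (Subtype.coe_le_coe.1 (le_top : (Y.ofDual : Submodule ℝ V) ≤ ⊤))

theorem flat_le_iff (h : ι → Submodule ℝ V) (D : Finset ι)
    (Y : IntersectionPoset (Finset.univ.image h)) :
    flat h D ≤ Y ↔ ∀ i ∈ D, (Y.ofDual : Submodule ℝ V) ≤ h i := by
  have : flat h D ≤ Y ↔ (Y.ofDual : Submodule ℝ V) ≤ ⨅ i ∈ D, h i := Iff.rfl
  rw [this]
  simp

/-- Only the whole space lies in no member of a family of proper subspaces. -/
theorem filter_le_eq_empty_iff (h : ι → Submodule ℝ V) (hh : ∀ i, h i ≠ ⊤)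
    (Y : IntersectionPoset (Finset.univ.image h)) :
    (Finset.univ.filter fun i => (Y.ofDual : Submodule ℝ V) ≤ h i) = ∅ ↔ ambient _ = Y := by
  rw [Finset.filter_eq_empty_iff]
  constructor
  · intro hY
    obtain ⟨B, hB, hBY⟩ := mem_intersections.1 Y.ofDual.2
    refine le_antisymm (ambient_le _ Y) ?_
    change (⊤ : Submodule ℝ V) ≤ (Y.ofDual : Submodule ℝ V)
    rw [← hBY, top_le_iff, sInf_eq_top]
    intro H hH
    obtain ⟨i, -, rfl⟩ := Finset.mem_image.1 (hB hH)
    exact absurd (hBY ▸ sInf_le hH) (hY (Finset.mem_univ i))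
  · rintro rfl i - hi
    exact hh i (top_le_iff.1 hi)

theorem mu_ambient (h : ι → Submodule ℝ V) (hh : ∀ i, h i ≠ ⊤)
    (Y : IntersectionPoset (Finset.univ.image h)) :
    IncidenceAlgebra.mu ℤ (ambient _) Y =
      ∑ D : Finset ι with flat h D = Y, (-1 : ℤ) ^ D.card := by
  symm
  refine eq_mu_of_sum_Icc (ambient _) (fun Y => ∑ D : Finset ι with flat h D = Y,
    (-1 : ℤ) ^ D.card) (ambient_le _) (fun Z => ?_) Y
  have h1 : (Finset.univ.filter fun D : Finset ι => flat h D ∈ Finset.Icc (ambient _) Z) =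
      (Finset.univ.filter fun i => (Z.ofDual : Submodule ℝ V) ≤ h i).powerset := by
    ext D
    simp only [Finset.mem_filter, Finset.mem_univ, true_and, Finset.mem_Icc, ambient_le,
      flat_le_iff, Finset.mem_powerset, Finset.subset_iff]
  have h2 : ∑ c ∈ Finset.Icc (ambient _) Z, ∑ D : Finset ι with flat h D = c, (-1 : ℤ) ^ D.card =
      ∑ D : Finset ι with flat h D ∈ Finset.Icc (ambient _) Z, (-1 : ℤ) ^ D.card := by
    rw [← Finset.sum_fiberwise_of_maps_to (g := flat h) (t := Finset.Icc (ambient _) Z)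
      fun D hD => (Finset.mem_filter.1 hD).2]
    refine Finset.sum_congr rfl fun c hc => Finset.sum_congr ?_ fun _ _ => rfl
    ext D
    simp only [Finset.mem_filter, Finset.mem_univ, true_and]
    exact ⟨fun hD => ⟨hD ▸ hc, hD⟩, fun hD => hD.2⟩
  rw [h2, h1, Finset.sum_powerset_neg_one_pow_card]
  exact if_congr (filter_le_eq_empty_iff h hh Z) rfl rfl

/-- Whitney's theorem, for a family of proper subspaces in which repetitions are allowed. -/
theorem charPoly_image (h : ι → Submodule ℝ V) (hh : ∀ i, h i ≠ ⊤) :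
    charPoly (Finset.univ.image h) =
      ∑ D : Finset ι, (-1 : ℤ[X]) ^ D.card * X ^ Module.finrank ℝ ↥(⨅ i ∈ D, h i) := by
  rw [charPoly, ← Finset.sum_fiberwise (s := Finset.univ) (g := flat h)]
  refine Finset.sum_congr rfl fun Y _ => ?_
  rw [mu_ambient h hh, map_sum, Finset.sum_mul]
  refine Finset.sum_congr rfl fun D hD => ?_
  obtain rfl := (Finset.mem_filter.1 hD).2
  rw [map_pow, map_neg, map_one]
  rfl

end Whitney

/-! ### Counting sign patterns by deletion and restriction -/

section SignPatterns

open scoped Classical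
open Module

variable {V : Type*} [AddCommGroup V] [Module ℝ V] {ι : Type*}

/-- At `x` the functionals `f i`, `i ∈ s`, are nonzero, and `P` is the set of the positive ones
(among the indices in `s`). -/
def HasPattern (f : ι → Dual ℝ V) (s P : Finset ι) (x : V) : Prop :=
  ∀ i ∈ s, (i ∈ P → 0 < f i x) ∧ (i ∉ P → f i x < 0)

/-- The sign patterns, encoded by the set of positive indices, which the functionals `f i`, `i ∈ s`,
realize on the subspace `W`. -/
noncomputable def realizable (f : ι → Dual ℝ V) (W : Submodule ℝ V) (s : Finset ι) :
    Finset (Finset ι) :=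
  s.powerset.filter fun P => ∃ x ∈ W, HasPattern f s P x

/-- A sign pattern without zeros persists under small perturbations in any direction. -/
theorem HasPattern.exists_add_smul {f : ι → Dual ℝ V} {s P : Finset ι} {x : V}
    (hx : HasPattern f s P x) (w : V) : ∃ ε : ℝ, 0 < ε ∧ HasPattern f s P (x + ε • w) := by
  have key : ∀ᶠ ε in nhdsWithin (0 : ℝ) (Set.Ioi 0), HasPattern f s P (x + ε • w) := by
    refine (Filter.eventually_all_finset s).2 fun i hi => ?_
    have hc : Filter.Tendsto (fun ε : ℝ => f i (x + ε • w)) (nhdsWithin 0 (Set.Ioi 0))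
        (nhds (f i x)) := by
      have : Continuous fun ε : ℝ => f i (x + ε • w) := by
        simp only [map_add, map_smul, smul_eq_mul]
        fun_prop
      have h := this.tendsto 0
      simp only [zero_smul, add_zero] at h
      exact h.mono_left nhdsWithin_le_nhds
    by_cases hP : i ∈ P
    · filter_upwards [hc.eventually (lt_mem_nhds ((hx i hi).1 hP))] with ε hε
      exact ⟨fun _ => hε, fun h => absurd hP h⟩
    · filter_upwards [hc.eventually (gt_mem_nhds ((hx i hi).2 hP))] with ε hε
      exact ⟨fun h => absurd h hP, fun _ => hε⟩
  obtain ⟨ε, hε, hpos⟩ := (key.and self_mem_nhdsWithin).exists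
  exact ⟨ε, hpos, hε⟩

/-- The points with a given sign pattern form a convex cone. -/
theorem HasPattern.smul_add_smul {f : ι → Dual ℝ V} {s P : Finset ι} {x y : V}
    (hx : HasPattern f s P x) (hy : HasPattern f s P y) {c d : ℝ} (hc : 0 ≤ c) (hd : 0 ≤ d)
    (hcd : 0 < c + d) : HasPattern f s P (c • x + d • y) := by
  intro i hi
  simp only [map_add, map_smul, smul_eq_mul]
  rcases hc.eq_or_lt with rfl | hc
  · have hd : 0 < d := by simpa using hcd
    refine ⟨fun h => ?_, fun h => ?_⟩
    · have := mul_pos hd ((hy i hi).1 h)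
      linarith
    · have := mul_neg_of_pos_of_neg hd ((hy i hi).2 h)
      linarith
  · refine ⟨fun h => ?_, fun h => ?_⟩
    · have := mul_pos hc ((hx i hi).1 h)
      have := mul_nonneg hd ((hy i hi).1 h).le
      linarith
    · have := mul_neg_of_pos_of_neg hc ((hx i hi).2 h)
      have := mul_nonpos_of_nonneg_of_nonpos hd ((hy i hi).2 h).le
      linarith

theorem hasPattern_insert_iff {f : ι → Dual ℝ V} {s P : Finset ι} {g : ι} {x : V} :
    HasPattern f (insert g s) P x ↔
      ((g ∈ P → 0 < f g x) ∧ (g ∉ P → f g x < 0)) ∧ HasPattern f s P x := by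
  simp [HasPattern]

theorem hasPattern_insert_right_iff {f : ι → Dual ℝ V} {s P : Finset ι} {g : ι} (hg : g ∉ s)
    {x : V} : HasPattern f s (insert g P) x ↔ HasPattern f s P x := by
  refine forall₂_congr fun i hi => ?_
  have : i ≠ g := fun h => hg (h ▸ hi)
  simp [this]

/-- Deletion and restriction for sign patterns. A pattern on `s` extends in two ways to
`insert g s` when it is realized on both sides of `ker (f g)`, that is, on `ker (f g)` itself, and
in one way otherwise. -/
theorem card_realizable_insert (f : ι → Dual ℝ V) (W : Submodule ℝ V) (s : Finset ι) (g : ι)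
    (hg : g ∉ s) (hW : ¬ W ≤ LinearMap.ker (f g)) :
    (realizable f W (insert g s)).card =
      (realizable f W s).card + (realizable f (W ⊓ LinearMap.ker (f g)) s).card := by
  obtain ⟨w, hwW, hw⟩ : ∃ w ∈ W, 0 < f g w := by
    obtain ⟨w, hwW, hw⟩ := SetLike.not_le_iff_exists.1 hW
    rcases lt_or_gt_of_ne (fun h => hw (LinearMap.mem_ker.2 h)) with h | h
    · exact ⟨-w, W.neg_mem hwW, by simpa using h⟩
    · exact ⟨w, hwW, h⟩
  set pos := s.powerset.filter fun P => ∃ x ∈ W, HasPattern f s P x ∧ 0 < f g x with hpos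
  set neg := s.powerset.filter fun P => ∃ x ∈ W, HasPattern f s P x ∧ f g x < 0 with hneg
  have hnot : ∀ P ∈ s.powerset, g ∉ P := fun P hP h => hg (Finset.mem_powerset.1 hP h)
  have h1 : realizable f W (insert g s) = neg ∪ pos.image (insert g) := by
    rw [realizable, Finset.powerset_insert, Finset.filter_union]
    congr 1
    · refine Finset.filter_congr fun P hP => ?_
      simp only [hasPattern_insert_iff, hnot P hP, false_imp_iff, true_and, not_false_eq_true,
        true_imp_iff, and_comm (b := HasPattern f s P _)]
    · rw [Finset.filter_image]
      refine congrArg _ (Finset.filter_congr fun P _ => ?_)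
      simp only [hasPattern_insert_iff, hasPattern_insert_right_iff hg, Finset.mem_insert_self,
        not_true_eq_false, false_imp_iff, and_true, true_imp_iff,
        and_comm (b := HasPattern f s P _)]
  have h2 : (realizable f W (insert g s)).card = neg.card + pos.card := by
    rw [h1, Finset.card_union_of_disjoint, Finset.card_image_of_injOn]
    · intro P hP Q hQ hPQ
      rw [← Finset.erase_insert (hnot P (Finset.mem_filter.1 hP).1),
        ← Finset.erase_insert (hnot Q (Finset.mem_filter.1 hQ).1)]
      exact congrArg (fun R => Finset.erase R g) hPQ
    · rw [Finset.disjoint_left]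
      intro P hP hP'
      obtain ⟨Q, -, rfl⟩ := Finset.mem_image.1 hP'
      exact hnot _ (Finset.mem_filter.1 hP).1 (Finset.mem_insert_self g Q)
  have h3 : neg ∪ pos = realizable f W s := by
    rw [hpos, hneg, realizable, ← Finset.filter_or]
    refine Finset.filter_congr fun P _ => ⟨?_, ?_⟩
    · rintro (⟨x, hx, h, -⟩ | ⟨x, hx, h, -⟩) <;> exact ⟨x, hx, h⟩
    · rintro ⟨x, hx, h⟩
      rcases lt_trichotomy (f g x) 0 with h0 | h0 | h0
      · exact Or.inl ⟨x, hx, h, h0⟩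
      · obtain ⟨ε, hε, h'⟩ := h.exists_add_smul w
        refine Or.inr ⟨_, W.add_mem hx (W.smul_mem ε hwW), h', ?_⟩
        simpa [h0] using mul_pos hε hw
      · exact Or.inr ⟨x, hx, h, h0⟩
  have h4 : neg ∩ pos = realizable f (W ⊓ LinearMap.ker (f g)) s := by
    rw [hpos, hneg, realizable, ← Finset.filter_and]
    refine Finset.filter_congr fun P _ => ⟨?_, ?_⟩
    · rintro ⟨⟨x, hx, h, h0⟩, y, hy, h', h0'⟩
      -- the point where the segment from `x` to `y` crosses `ker (f g)`, up to scaling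
      refine ⟨f g y • x + (-f g x) • y, ⟨W.add_mem (W.smul_mem _ hx) (W.smul_mem _ hy), ?_⟩,
        h.smul_add_smul h' h0'.le (by linarith) (by linarith)⟩
      simp only [SetLike.mem_coe, LinearMap.mem_ker, map_add, map_smul, smul_eq_mul]
      ring
    · rintro ⟨x, ⟨hx, hxk⟩, h⟩
      have hxk : f g x = 0 := hxk
      obtain ⟨ε, hε, h'⟩ := h.exists_add_smul w
      obtain ⟨δ, hδ, h''⟩ := h.exists_add_smul (-w)
      refine ⟨⟨_, W.add_mem hx (W.smul_mem δ (W.neg_mem hwW)), h'', ?_⟩,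
        _, W.add_mem hx (W.smul_mem ε hwW), h', ?_⟩
      · simpa [hxk] using mul_pos hδ hw
      · simpa [hxk] using mul_pos hε hw
  rw [h2, ← h3, ← h4, Finset.card_union_add_card_inter]

theorem finrank_inf_ker_add_one [FiniteDimensional ℝ V] (W : Submodule ℝ V) (g : Dual ℝ V)
    (hW : ¬ W ≤ LinearMap.ker g) :
    finrank ℝ ↥(W ⊓ LinearMap.ker g) + 1 = finrank ℝ W := by
  have h0 : g.domRestrict W ≠ 0 := by
    intro h
    refine hW fun x hx => ?_
    simpa using LinearMap.congr_fun h ⟨x, hx⟩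
  rw [← Module.Dual.finrank_ker_add_one_of_ne_zero h0, LinearMap.ker_domRestrict,
    ← Submodule.finrank_map_subtype_eq, Submodule.map_comap_subtype]

/-- The number of sign patterns on a subspace `W` is the alternating sum
`∑ (-1) ^ (#B + codim B)` over all subfamilies, where `codim B` is the codimension in `W` of the
common kernel. It appears here with `dim W + dim` in place of `dim W - dim`. -/
theorem card_realizable [FiniteDimensional ℝ V] (f : ι → Dual ℝ V) (s : Finset ι)
    (W : Submodule ℝ V) :
    ((realizable f W s).card : ℤ) = ∑ B ∈ s.powerset,
      (-1) ^ (B.card + finrank ℝ W + finrank ℝ ↥(W ⊓ ⨅ i ∈ B, LinearMap.ker (f i))) := by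
  induction s using Finset.induction_on generalizing W with
  | empty =>
    have : realizable f W ∅ = {∅} := by
      rw [realizable, Finset.powerset_empty, Finset.filter_singleton, if_pos]
      exact ⟨0, W.zero_mem, by simp [HasPattern]⟩
    have hinf : W ⊓ ⨅ i ∈ (∅ : Finset ι), LinearMap.ker (f i) = W := by simp
    rw [this, Finset.powerset_empty, Finset.sum_singleton, hinf]
    simp [← two_mul]
  | insert g s hg ih =>
    have hcard : ∀ B ∈ s.powerset, (insert g B).card = B.card + 1 := fun B hB =>
      Finset.card_insert_of_notMem fun h => hg (Finset.mem_powerset.1 hB h)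
    rw [Finset.sum_powerset_insert hg]
    by_cases hW : W ≤ LinearMap.ker (f g)
    · -- `f g` vanishes on `W`: there are no patterns, and `B` cancels against `insert g B`
      have h0 : realizable f W (insert g s) = ∅ := by
        refine Finset.filter_eq_empty_iff.2 ?_
        rintro P - ⟨x, hx, h⟩
        have h0 : f g x = 0 := hW hx
        rw [hasPattern_insert_iff, h0] at h
        by_cases hP : g ∈ P
        · exact lt_irrefl _ (h.1.1 hP)
        · exact lt_irrefl _ (h.1.2 hP)
      rw [h0, Finset.card_empty, Nat.cast_zero, ← Finset.sum_add_distrib, eq_comm]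
      refine Finset.sum_eq_zero fun B hB => ?_
      rw [hcard B hB, Finset.iInf_insert, ← inf_assoc, inf_eq_left.2 hW]
      ring
    · rw [card_realizable_insert f W s g hg hW, Nat.cast_add, ih W, ih]
      congr 1
      refine Finset.sum_congr rfl fun B hB => ?_
      rw [hcard B hB, Finset.iInf_insert, ← inf_assoc, ← finrank_inf_ker_add_one W (f g) hW]
      ring

end SignPatterns

/-! ### Regions and Zaslavsky's theorem -/

section Regions

open scoped Classical
open Module

variable {V : Type*} [AddCommGroup V] [Module ℝ V] {ι : Type*} [Fintype ι]

/-- The set of indices whose functional is positive at a given point. -/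
noncomputable def positiveSet (f : ι → Dual ℝ V) (x : V) : Finset ι :=
  Finset.univ.filter fun i => 0 < f i x

theorem hasPattern_univ_iff {f : ι → Dual ℝ V} {P : Finset ι} {x : V} :
    HasPattern f Finset.univ P x ↔ (∀ i, f i x ≠ 0) ∧ positiveSet f x = P := by
  constructor
  · intro h
    refine ⟨fun i => ?_, ?_⟩
    · by_cases hi : i ∈ P
      · exact ((h i (Finset.mem_univ i)).1 hi).ne'
      · exact ((h i (Finset.mem_univ i)).2 hi).ne
    · ext i
      simp only [positiveSet, Finset.mem_filter, Finset.mem_univ, true_and]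
      refine ⟨fun hi => ?_, (h i (Finset.mem_univ i)).1⟩
      by_contra hP
      exact hi.not_gt ((h i (Finset.mem_univ i)).2 hP)
  · rintro ⟨h0, rfl⟩ i -
    simp only [positiveSet, Finset.mem_filter, Finset.mem_univ, true_and, not_lt]
    exact ⟨id, fun h => lt_of_le_of_ne h (h0 i)⟩

variable [TopologicalSpace V]

theorem isLocallyConstant_positiveSet (f : ι → Dual ℝ V) (hf : ∀ i, Continuous (f i)) (U : Set V)
    (hU : ∀ x ∈ U, ∀ i, f i x ≠ 0) : IsLocallyConstant fun x : U => positiveSet f x := by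
  refine (IsLocallyConstant.iff_eventually_eq _).2 fun x => ?_
  have h : ∀ i, ∀ᶠ y : U in nhds x, (0 < f i y ↔ 0 < f i x) := by
    intro i
    have hc : Filter.Tendsto (fun y : U => f i y) (nhds x) (nhds (f i x)) :=
      ((hf i).comp continuous_subtype_val).tendsto x
    rcases lt_or_gt_of_ne (hU x x.2 i) with h | h
    · filter_upwards [hc.eventually (gt_mem_nhds h)] with y hy
      exact iff_of_false hy.not_gt h.not_gt
    · filter_upwards [hc.eventually (lt_mem_nhds h)] with y hy
      exact iff_of_true hy h
  filter_upwards [Filter.eventually_all.2 h] with y hy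
  simp only [positiveSet, hy]

variable [IsTopologicalAddGroup V] [ContinuousSMul ℝ V]

theorem isPreconnected_setOf_hasPattern (f : ι → Dual ℝ V) (P : Finset ι) :
    IsPreconnected {x | HasPattern f Finset.univ P x} := by
  refine Convex.isPreconnected fun x hx y hy c d hc hd hcd => ?_
  exact HasPattern.smul_add_smul hx hy hc hd (by rw [hcd]; exact one_pos)

/-- The components of the locus where no `f i` vanishes correspond to the realizable sign
patterns. -/
theorem card_connectedComponents_eq (f : ι → Dual ℝ V) (hf : ∀ i, Continuous (f i)) (U : Set V)
    (hU : ∀ x, x ∈ U ↔ ∀ i, f i x ≠ 0) :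
    Nat.card (ConnectedComponents U) = (realizable f ⊤ Finset.univ).card := by
  let _ : TopologicalSpace (Finset ι) := ⊥
  have : DiscreteTopology (Finset ι) := ⟨rfl⟩
  have hc : Continuous fun x : U => positiveSet f x :=
    (isLocallyConstant_positiveSet f hf U fun x hx => (hU x).1 hx).continuous
  have hpat : ∀ x : U, HasPattern f Finset.univ (positiveSet f x) x := fun x =>
    hasPattern_univ_iff.2 ⟨(hU x).1 x.2, rfl⟩
  have hinj : Function.Injective hc.connectedComponentsLift := by
    intro p q hpq
    obtain ⟨x, rfl⟩ := ConnectedComponents.surjective_coe p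
    obtain ⟨y, rfl⟩ := ConnectedComponents.surjective_coe q
    replace hpq : positiveSet f x = positiveSet f y := hpq
    have hpre : IsPreconnected
        {z : U | HasPattern f Finset.univ (positiveSet f y) z} := by
      refine Topology.IsInducing.subtypeVal.isPreconnected_image.1 ?_
      convert isPreconnected_setOf_hasPattern f (positiveSet f y) using 1
      ext z
      constructor
      · rintro ⟨z, hz, rfl⟩
        exact hz
      · intro hz
        exact ⟨⟨z, (hU z).2 (hasPattern_univ_iff.1 hz).1⟩, hz, rfl⟩
    refine ConnectedComponents.coe_eq_coe'.2 (hpre.subset_connectedComponent (hpat y) ?_)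
    change HasPattern f Finset.univ (positiveSet f y) x
    exact hpq ▸ hpat x
  have hrange : Set.range hc.connectedComponentsLift =
      (realizable f ⊤ Finset.univ : Set (Finset ι)) := by
    ext P
    simp only [realizable, Finset.powerset_univ, Submodule.mem_top, true_and, Finset.coe_filter,
      Finset.mem_univ, Set.mem_range, Set.mem_ofPred_eq]
    constructor
    · rintro ⟨p, rfl⟩
      obtain ⟨x, rfl⟩ := ConnectedComponents.surjective_coe p
      exact ⟨x, hpat x⟩
    · rintro ⟨x, hx⟩
      obtain ⟨h0, rfl⟩ := hasPattern_univ_iff.1 hx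
      exact ⟨ConnectedComponents.mk ⟨x, (hU x).2 h0⟩, rfl⟩
  rw [← Nat.card_range_of_injective hinj, hrange]
  simp

/-- Zaslavsky's theorem, for a family of kernels of functionals. -/
theorem natCast_numRegions_image [T2Space V] [FiniteDimensional ℝ V] (h : ι → Submodule ℝ V)
    (f : ι → Dual ℝ V) (hf : ∀ i, h i = LinearMap.ker (f i)) :
    (numRegions (Finset.univ.image h) : ℤ) = ∑ D : Finset ι,
      (-1) ^ (D.card + finrank ℝ V + finrank ℝ ↥(⨅ i ∈ D, h i)) := by
  have hU : ∀ x, x ∈ (⋃ H ∈ Finset.univ.image h, (H : Set V))ᶜ ↔ ∀ i, f i x ≠ 0 := by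
    intro x
    simp [hf]
  rw [numRegions, card_connectedComponents_eq f
    (fun i => LinearMap.continuous_of_finiteDimensional (f i)) _ hU, card_realizable,
    Finset.powerset_univ]
  refine Finset.sum_congr rfl fun D _ => ?_
  have hinf : ⨅ i ∈ D, h i = ⊤ ⊓ ⨅ i ∈ D, LinearMap.ker (f i) := by simp only [top_inf_eq, hf]
  rw [hinf, finrank_top]

end Regions

/-! ### The hyperplanes of the discriminantal arrangement -/

section Systems

open scoped Classical

variable {n m : ℕ}

/-- The linear functional whose kernel is the hyperplane of a block. -/
noncomputable def blockFunctional (a : Matrix (Fin n) (Fin m) ℝ) (S : Block n m) :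
    Module.Dual ℝ (Fin n → ℝ) where
  toFun y := (augmented a S y).det
  map_add' y z := by
    rw [augmented_eq_updateCol a S y, augmented_eq_updateCol a S z,
      augmented_eq_updateCol a S (y + z)]
    exact Matrix.det_updateCol_add (augmented a S 0) (Fin.last m)
      (fun k => y (S.1.orderEmbOfFin S.2 k)) (fun k => z (S.1.orderEmbOfFin S.2 k))
  map_smul' c y := by
    rw [augmented_eq_updateCol a S y, augmented_eq_updateCol a S (c • y)]
    exact Matrix.det_updateCol_smul (augmented a S 0) (Fin.last m) c
      (fun k => y (S.1.orderEmbOfFin S.2 k))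

theorem hyperplane_eq_ker (a : Matrix (Fin n) (Fin m) ℝ) (S : Block n m) :
    hyperplane a S = LinearMap.ker (blockFunctional a S) := rfl

/-- The functional of a block does not vanish on the basis vector of its last index, where it is the
minor formed by the rows of the other `m` indices. -/
theorem hyperplane_ne_top {L : Fin n → Submodule ℝ (Fin m → ℝ)} {a : Matrix (Fin n) (Fin m) ℝ}
    (hL : IsNormalSystem L) (ha : IsCoefficientMatrix L a) (S : Block n m) :
    hyperplane a S ≠ ⊤ := by
  intro htop
  set e := S.1.orderEmbOfFin S.2
  have hmem : (Pi.single (e (Fin.last m)) 1 : Fin n → ℝ) ∈ hyperplane a S := htop ▸ trivial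
  replace hmem : (augmented a S (Pi.single (e (Fin.last m)) 1)).det = 0 := hmem
  rw [Matrix.det_succ_column _ (Fin.last m), Fin.sum_univ_castSucc] at hmem
  have h0 : ∀ k : Fin m, (Pi.single (e (Fin.last m)) 1 : Fin n → ℝ) (e k.castSucc) = 0 :=
    fun k => Pi.single_eq_of_ne
      (fun h => (Fin.castSucc_lt_last k).ne (e.injective h)) _
  have hsub : (augmented a S (Pi.single (e (Fin.last m)) 1)).submatrix
      (Fin.last m).succAbove (Fin.last m).succAbove =
      Matrix.of fun k : Fin m => a (e k.castSucc) := by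
    ext k j
    simp [augmented, e]
  have hentry : ∀ k, augmented a S (Pi.single (e (Fin.last m)) 1) k (Fin.last m) =
      (Pi.single (e (Fin.last m)) 1 : Fin n → ℝ) (e k) := fun k => by simp [augmented, e]
  simp only [hentry, h0, mul_zero, zero_mul, Finset.sum_const_zero, zero_add, Pi.single_eq_same,
    mul_one, hsub, mul_eq_zero, pow_eq_zero_iff', neg_eq_zero, one_ne_zero, false_and,
    false_or] at hmem
  have hinj : Function.Injective fun k : Fin m => e k.castSucc :=
    e.injective.comp (Fin.castSucc_injective m)
  set s : Finset (Fin n) := Finset.univ.image fun k : Fin m => e k.castSucc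
  have hs : s.card ≤ m := by
    simpa using Finset.card_image_le (s := Finset.univ) (f := fun k : Fin m => e k.castSucc)
  have hli := hL.linearIndependent a ha s hs
  have hli' : LinearIndependent ℝ (Matrix.of fun k : Fin m => a (e k.castSucc)).row :=
    hli.comp (fun k : Fin m => (⟨e k.castSucc, Finset.mem_image_of_mem _ (Finset.mem_univ k)⟩ : s))
      fun k l hkl => hinj (congrArg (fun i : s => (i : Fin n)) hkl)
  rw [Matrix.linearIndependent_rows_iff_isUnit, Matrix.isUnit_iff_isUnit_det, hmem] at hli'
  exact not_isUnit_zero hli'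

/-! ### Codimensions in a concurrency free system -/

theorem concurrencyClosure_idem (D : Finset (Block n m)) :
    concurrencyClosure (concurrencyClosure D) = concurrencyClosure D :=
  (concurrencyClosure_subset subset_rfl (isConcurrencyClosed_concurrencyClosure D)).antisymm
    (subset_concurrencyClosure _)

theorem exists_isBase_subset (D : Finset (Block n m)) :
    ∃ B ⊆ D, IsBase B (concurrencyClosure D) := by
  obtain ⟨B, hB⟩ := (Set.toFinite
    {B | B ⊆ D ∧ concurrencyClosure B = concurrencyClosure D}).exists_minimal
    ⟨D, subset_rfl, rfl⟩
  refine ⟨B, hB.prop.1, ?_, fun B' hB' h => ?_⟩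
  · rw [concurrencyClosure_idem, hB.prop.2]
  · rw [concurrencyClosure_idem] at h
    exact hB.eq_of_le ⟨hB'.trans hB.prop.1, h⟩ hB'

variable {a : Matrix (Fin n) (Fin m) ℝ}

/-- The collection `D` need not be closed here: it contains a base `B₀` of its closure, and the
intersection over `D` is squeezed between those over the closure and over `B₀`. -/
theorem ConcurrencyFree.card_add_finrank (hc : ConcurrencyFree a) {D B : Finset (Block n m)}
    (hB : IsBase B (concurrencyClosure D)) :
    B.card + Module.finrank ℝ ↥(⨅ S ∈ D, hyperplane a S) = n := by
  obtain ⟨B₀, hB₀D, hB₀⟩ := exists_isBase_subset D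
  have hcl := isConcurrencyClosed_concurrencyClosure D
  have h := (hc _ hcl B hB).1
  have h₀ := hc _ hcl B₀ hB₀
  have h1 : ⨅ S ∈ concurrencyClosure D, hyperplane a S ≤ ⨅ S ∈ D, hyperplane a S :=
    biInf_mono (subset_concurrencyClosure D)
  have h2 : ⨅ S ∈ D, hyperplane a S ≤ ⨅ S ∈ B₀, hyperplane a S := biInf_mono hB₀D
  have h1' := Submodule.finrank_mono h1
  have h2' := Submodule.finrank_mono h2
  omega

theorem ConcurrencyFree.card_eq_collectionRank (hc : ConcurrencyFree a)
    {D B : Finset (Block n m)} (hB : IsBase B (concurrencyClosure D)) :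
    B.card = collectionRank (concurrencyClosure D) := by
  obtain ⟨B', hB', h⟩ := Nat.sInf_mem
    (s := {k | ∃ B, IsBase B (concurrencyClosure D) ∧ B.card = k}) ⟨_, B, hB, rfl⟩
  have h1 := hc.card_add_finrank hB
  have h2 := hc.card_add_finrank hB'
  rw [collectionRank, ← h]
  omega

theorem ConcurrencyFree.collectionRank_add_finrank (hc : ConcurrencyFree a)
    (D : Finset (Block n m)) :
    collectionRank (concurrencyClosure D) +
      Module.finrank ℝ ↥(⨅ S ∈ D, hyperplane a S) = n := by
  obtain ⟨B, hB⟩ := exists_isBase (concurrencyClosure D)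
  rw [← hc.card_eq_collectionRank hB, hc.card_add_finrank hB]

theorem ConcurrencyFree.closureDim_eq (hc : ConcurrencyFree a) (D : Finset (Block n m)) :
    closureDim D = Module.finrank ℝ ↥(⨅ S ∈ D, hyperplane a S) := by
  have := hc.collectionRank_add_finrank D
  rw [closureDim]
  omega

/-! ### The characteristic polynomial and the number of regions -/

theorem ConcurrencyFree.charPoly_eq {L : Fin n → Submodule ℝ (Fin m → ℝ)} (hL : IsNormalSystem L)
    (ha : IsCoefficientMatrix L a) (hc : ConcurrencyFree a) :
    charPoly (discriminantalArrangement a) =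
      ∑ D : Finset (Block n m), (-1 : ℤ[X]) ^ D.card * X ^ closureDim D := by
  simp only [hc.closureDim_eq]
  exact charPoly_image (hyperplane a) (hyperplane_ne_top hL ha)

theorem ConcurrencyFree.natCast_numRegions_eq (hc : ConcurrencyFree a) :
    (numRegions (discriminantalArrangement a) : ℤ) =
      ∑ D : Finset (Block n m), (-1) ^ (n + D.card + closureDim D) := by
  rw [discriminantalArrangement,
    natCast_numRegions_image (hyperplane a) (blockFunctional a) (hyperplane_eq_ker a)]
  refine Finset.sum_congr rfl fun D _ => ?_
  rw [hc.closureDim_eq, Module.finrank_fin_fun, add_comm D.card n]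

end Systems

end Discriminantal

theorem mainTheorem4 (n m : ℕ) (hm : 1 < m) (hmn : m < n) :
    (∀ (L : Fin n → Submodule ℝ (Fin m → ℝ)) (a : Matrix (Fin n) (Fin m) ℝ),
      Discriminantal.IsNormalSystem L → Discriminantal.IsCoefficientMatrix L a →
      Discriminantal.ConcurrencyFree a →
      (∀ D B : Finset (Discriminantal.Block n m),
        Discriminantal.IsBase B (Discriminantal.concurrencyClosure D) →
          B.card = Discriminantal.collectionRank (Discriminantal.concurrencyClosure D)) ∧
      (∀ D : Finset (Discriminantal.Block n m),
        Discriminantal.collectionRank (Discriminantal.concurrencyClosure D) ≤ n) ∧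
      Discriminantal.charPoly (Discriminantal.discriminantalArrangement a) =
        ∑ D : Finset (Discriminantal.Block n m),
          (-1 : ℤ[X]) ^ D.card * X ^ Discriminantal.closureDim D ∧
      (Discriminantal.numRegions (Discriminantal.discriminantalArrangement a) : ℤ) =
        (-1) ^ n *
          (Discriminantal.charPoly (Discriminantal.discriminantalArrangement a)).eval (-1) ∧
      (Discriminantal.numRegions (Discriminantal.discriminantalArrangement a) : ℤ) =
        ∑ D : Finset (Discriminantal.Block n m),
          (-1) ^ (n + D.card + Discriminantal.closureDim D) ∧
      (Discriminantal.numRegions (Discriminantal.discriminantalArrangement a) : ℤ) =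
        ∑ D : Finset (Discriminantal.Block n m),
          (-1) ^ (D.card +
            Discriminantal.collectionRank (Discriminantal.concurrencyClosure D))) ∧
    (∀ (L L' : Fin n → Submodule ℝ (Fin m → ℝ)) (a a' : Matrix (Fin n) (Fin m) ℝ),
      Discriminantal.IsNormalSystem L → Discriminantal.IsCoefficientMatrix L a →
      Discriminantal.ConcurrencyFree a →
      Discriminantal.IsNormalSystem L' → Discriminantal.IsCoefficientMatrix L' a' →
      Discriminantal.ConcurrencyFree a' →
      Discriminantal.charPoly (Discriminantal.discriminantalArrangement a) =
        Discriminantal.charPoly (Discriminantal.discriminantalArrangement a') ∧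
      Discriminantal.numRegions (Discriminantal.discriminantalArrangement a) =
        Discriminantal.numRegions (Discriminantal.discriminantalArrangement a')) := by
  refine ⟨fun L a hL ha hc => ?_, fun L L' a a' hL ha hc hL' ha' hc' => ⟨?_, ?_⟩⟩
  · refine ⟨fun D B hB => hc.card_eq_collectionRank hB, fun D => ?_, hc.charPoly_eq hL ha, ?_,
      hc.natCast_numRegions_eq, ?_⟩
    · have := hc.collectionRank_add_finrank D
      omega
    · rw [hc.natCast_numRegions_eq, hc.charPoly_eq hL ha, Polynomial.eval_finsetSum,
        Finset.mul_sum]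
      refine Finset.sum_congr rfl fun D _ => ?_
      simp [pow_add, mul_assoc]
    · rw [hc.natCast_numRegions_eq]
      refine Finset.sum_congr rfl fun D _ => ?_
      -- `n + closureDim D` and the rank differ by the even number `2 * closureDim D`
      have h := hc.collectionRank_add_finrank D
      rw [← hc.closureDim_eq D] at h
      rw [show n + D.card + Discriminantal.closureDim D = D.card +
        Discriminantal.collectionRank (Discriminantal.concurrencyClosure D) +
        2 * Discriminantal.closureDim D by omega, pow_add _ _ (2 * _), pow_mul]
      simp
  · rw [hc.charPoly_eq hL ha, hc'.charPoly_eq hL' ha']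
  · rw [← Nat.cast_inj (R := ℤ), hc.natCast_numRegions_eq, hc'.natCast_numRegions_eq]
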